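/- Let $\mathcal K\subseteq\mathbb R^d$ be a polyhedral convex cone that is self-dual, meaning that there is some inner product $\langle\cdot,\cdot\rangle$ on $\mathbb R^d$ with $\mathcal K=\mathcal K^*:=\{y\in\mathbb R^d : \langle x,y\rangle\ge 0 \text{ for all } x\in\mathcal K\}$. Let $S\in\mathbb R^{n\times n}$ be a slack matrix of $\mathcal K$, i.e. for some inner product $\langle\cdot,\cdot\rangle'$ on $\mathbb R^d$ (possibly a different one) we have $S_{ij}=\langle x_i,y_j\rangle'$, where $x_1,\dots,x_n$ generate the distinct extreme rays of $\mathcal K$ (one nonzero generator for each extreme ray) and $y_1,\dots,y_n$ generate, in the same sense, the distinct extreme rays of the dual cone of $\mathcal K$ with respect to $\langle\cdot,\cdot\rangle'$. Suppose that $S$ is symmetric positive semidefinite. If $S$ is not diagonal, then $S$ is not completely positive semidefinite; that is, there are no $k$ and real symmetric positive semidefinite $k\times k$ matrices $A_1,\dots,A_n$ such that $S_{ij}=\operatorname{tr}(A_iA_j)$ for all $i,j$. -/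

import Mathlib

namespace SelfDualSlack

section Cones

variable {E : Type*} [AddCommGroup E] [Module ℝ E]

/-- An inner product on a real vector space: a symmetric positive definite bilinear form. -/
def IsInnerProduct (B : LinearMap.BilinForm ℝ E) : Prop :=
  B.IsSymm ∧ ∀ x : E, x ≠ 0 → 0 < B x x

/-- A convex cone is polyhedral if it is the solution set of finitely many linear inequalities
`0 ≤ f x` (an equality is a pair of opposite inequalities). -/
def IsPolyhedral (K : PointedCone ℝ E) : Prop :=
  K.DualFG (LinearMap.id : Module.Dual ℝ E →ₗ[ℝ] Module.Dual ℝ E)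

/-- `K` is self-dual if `K = {y | ∀ x ∈ K, 0 ≤ ⟨x, y⟩}` for some inner product `⟨·,·⟩`. -/
def IsSelfDual (K : PointedCone ℝ E) : Prop :=
  ∃ B : LinearMap.BilinForm ℝ E, IsInnerProduct B ∧ PointedCone.dual B (K : Set E) = K

/-- An extreme ray of `K` is a face of the form `{α • x | 0 ≤ α}` with `x ≠ 0`. -/
def IsExtremeRay (K F : PointedCone ℝ E) : Prop :=
  F.IsFaceOf K ∧ ∃ x : E, x ≠ 0 ∧ F = PointedCone.hull ℝ {x}

/-- The family `x` consists of generators of all the extreme rays of `K`, exactly one generator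
for each extreme ray. -/
def GeneratesExtremeRays {ι : Type*} (K : PointedCone ℝ E) (x : ι → E) : Prop :=
  Set.BijOn (fun i => PointedCone.hull ℝ {x i}) Set.univ {F | IsExtremeRay K F}

/-- `M` is a slack matrix of `K`: for some inner product, `M i j = ⟨x i, y j⟩` where the `x i` are
generators of the distinct extreme rays of `K` and the `y j` are generators of the distinct extreme
rays of the dual cone of `K`. (This is meant for pointed full-dimensional polyhedral cones, which
self-dual polyhedral cones are automatically.) -/
def IsSlackMatrix {ι κ : Type*} (K : PointedCone ℝ E) (M : Matrix ι κ ℝ) : Prop :=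
  ∃ B : LinearMap.BilinForm ℝ E, IsInnerProduct B ∧
    ∃ (x : ι → E) (y : κ → E),
      GeneratesExtremeRays K x ∧
      GeneratesExtremeRays (PointedCone.dual B (K : Set E)) y ∧
      ∀ i j, M i j = B (x i) (y j)

end Cones

/-- `M` is completely positive semidefinite: `M i j = tr (A i * A j)` for real symmetric positive
semidefinite matrices `A i` of some common size. -/
def IsCompletelyPosSemidef {ι : Type*} (M : Matrix ι ι ℝ) : Prop :=
  ∃ (k : ℕ) (A : ι → Matrix (Fin k) (Fin k) ℝ),
    (∀ i, (A i).PosSemidef) ∧ ∀ i j, M i j = (A i * A j).trace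

end SelfDualSlack

/-! Suppose `S i j = tr (A i * A j)`. Self-duality makes every nonnegative vector of the row space a
nonnegative combination of rows (`IsSlackMatrix.rows_extreme`), so `∑ p i • A i` is PSD whenever `p
ᵥ* S ≥ 0`. Let `a ≠ b` with `S a b > 0`, let `D` be the projection of `A b` onto the face orthogonal
to `A a`, and let `C = A b - D`. Then `A a * D = 0`, and `s • A a - C` is PSD for large `s`.

PSD matrices with trace-zero product have product zero, so `(s • A a - C) * D = 0` and hence `C * D
= 0`. As `C + D` is PSD, so is `C`. Thus `A b = C + D` inside the cone; extremality of `b` and `S a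
b > 0` force `D = 0`. Now `A b = C` lies below `s • A a`, so extremality of `a` makes the two rays
equal, a contradiction. -/

open Matrix

/-! ### Positive semidefinite matrices and orthogonality in the trace form. -/

namespace Matrix.PosSemidef

variable {m : Type*} [Fintype m]

open scoped MatrixOrder in
theorem exists_eq_conjTranspose_mul_self {X : Matrix m m ℝ} (hX : X.PosSemidef) :
    ∃ P : Matrix m m ℝ, X = Pᴴ * P := by
  classical
  exact CStarAlgebra.nonneg_iff_eq_star_mul_self.mp hX.nonneg

theorem trace_mul_nonneg {X Y : Matrix m m ℝ} (hX : X.PosSemidef) (hY : Y.PosSemidef) :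
    0 ≤ (X * Y).trace := by
  obtain ⟨P, rfl⟩ := hX.exists_eq_conjTranspose_mul_self
  rw [Matrix.mul_assoc, trace_mul_comm]
  exact (hY.mul_mul_conjTranspose_same P).trace_nonneg

/-- With `X = Pᴴ * P` and `Y = Qᴴ * Q`, the trace is the squared Frobenius norm of `P * Qᴴ`. -/
theorem mul_eq_zero_of_trace_mul_eq_zero {X Y : Matrix m m ℝ} (hX : X.PosSemidef)
    (hY : Y.PosSemidef) (h : (X * Y).trace = 0) : X * Y = 0 := by
  obtain ⟨P, rfl⟩ := hX.exists_eq_conjTranspose_mul_self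
  obtain ⟨Q, rfl⟩ := hY.exists_eq_conjTranspose_mul_self
  have h' : ((P * Qᴴ)ᴴ * (P * Qᴴ)).trace = 0 := by
    rw [← h, conjTranspose_mul, conjTranspose_conjTranspose, Matrix.mul_assoc, trace_mul_comm]
    simp only [Matrix.mul_assoc]
  have hPQ := trace_conjTranspose_mul_self_eq_zero_iff.mp h'
  calc Pᴴ * P * (Qᴴ * Q) = Pᴴ * (P * Qᴴ) * Q := by simp only [Matrix.mul_assoc]
    _ = 0 := by rw [hPQ]; simp

/-- A Hermitian matrix whose cube is positive semidefinite is positive semidefinite. -/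
theorem of_mul_mul_self {C : Matrix m m ℝ} (hC : C.IsHermitian)
    (h : (C * C * C).PosSemidef) : C.PosSemidef := by
  classical
  rw [hC.posSemidef_iff_eigenvalues_nonneg]
  intro i
  set v : m → ℝ := ⇑(hC.eigenvectorBasis i) with hv
  have hCv : C *ᵥ v = hC.eigenvalues i • v := hC.mulVec_eigenvectorBasis i
  have hne : v ≠ 0 := fun h0 => hC.eigenvectorBasis.orthonormal.ne_zero i (by
    ext j; simpa using congrFun h0 j)
  have hpos : 0 < v ⬝ᵥ v := by
    have := dotProduct_star_self_pos_iff.mpr hne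
    simpa using this
  have hq := h.dotProduct_mulVec_nonneg v
  rw [Matrix.mul_assoc, ← mulVec_mulVec, ← mulVec_mulVec, hCv, mulVec_smul, hCv, mulVec_smul,
    mulVec_smul, hCv] at hq
  simp only [star_trivial, dotProduct_smul, smul_eq_mul] at hq
  by_contra hneg
  have hneg : hC.eigenvalues i < 0 := lt_of_not_ge hneg
  have : 0 < hC.eigenvalues i * hC.eigenvalues i := mul_pos_of_neg_of_neg hneg hneg
  have h3 : 0 < hC.eigenvalues i * hC.eigenvalues i * (v ⬝ᵥ v) := mul_pos this hpos
  nlinarith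

/-- If `C` is Hermitian, `C * D = 0` and `C + D` is positive semidefinite, then `C` is positive
semidefinite. -/
theorem of_add_of_mul_eq_zero {C D : Matrix m m ℝ} (hC : C.IsHermitian) (hCD : C * D = 0)
    (h : (C + D).PosSemidef) : C.PosSemidef := by
  refine of_mul_mul_self hC ?_
  have := h.mul_mul_conjTranspose_same C
  rwa [hC.eq, Matrix.mul_add, hCD, add_zero] at this

end Matrix.PosSemidef

/-- The projection of the `b`-th generator onto the face orthogonal to the `a`-th generator, in a
cone given by the Gram matrix `S` of its generators. -/
theorem Matrix.PosSemidef.exists_projection_orthogonal_face {ι : Type*} [Fintype ι] [DecidableEq ι]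
    {S : Matrix ι ι ℝ} (hS : S.PosSemidef) (hnn : ∀ i j, 0 ≤ S i j) (a b : ι) :
    ∃ δ : ι → ℝ, (∀ j, 0 ≤ (S *ᵥ δ) j) ∧ (S *ᵥ δ) a = 0 ∧
      δ ⬝ᵥ (S *ᵥ (Pi.single b 1 - δ)) = 0 ∧
      ∀ k, S a k = 0 → (S *ᵥ (Pi.single b 1 - δ)) k ≤ 0 := by
  obtain ⟨R, hR⟩ := hS.exists_eq_conjTranspose_mul_self
  -- The vectors `U (Pi.single j 1)` have Gram matrix `S`; `N` below is the face orthogonal to the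
  -- `a`-th one.
  let U : (ι → ℝ) →ₗ[ℝ] EuclideanSpace ℝ ι :=
    (WithLp.linearEquiv 2 ℝ (ι → ℝ)).symm.toLinearMap ∘ₗ R.mulVecLin
  have hU : ∀ c c' : ι → ℝ, inner ℝ (U c) (U c') = c ⬝ᵥ (S *ᵥ c') := by
    intro c c'
    have : inner ℝ (U c) (U c') = (R *ᵥ c') ⬝ᵥ (R *ᵥ c) := by
      simp [U, EuclideanSpace.inner_eq_star_dotProduct]
    rw [this, hR, ← mulVec_mulVec, dotProduct_mulVec, dotProduct_comm c,
      conjTranspose_eq_transpose_of_trivial, mulVec_transpose]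
  let N : Set (EuclideanSpace ℝ ι) := (LinearMap.range U : Set _) ∩
    ((⋂ j, {v | 0 ≤ inner ℝ (U (Pi.single j 1)) v}) ∩ {v | inner ℝ (U (Pi.single a 1)) v = 0})
  have hN0 : (0 : EuclideanSpace ℝ ι) ∈ N := by simp [N]
  have hNclosed : IsClosed N := by
    refine (Submodule.closed_of_finiteDimensional _).inter (IsClosed.inter ?_ ?_)
    · exact isClosed_iInter fun j => isClosed_le continuous_const (by fun_prop)
    · exact isClosed_eq (by fun_prop) continuous_const
  have hNconv : Convex ℝ N := by
    rintro v ⟨hv1, hv2, hv3⟩ w ⟨hw1, hw2, hw3⟩ s t hs ht -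
    refine ⟨(LinearMap.range U).add_mem (Submodule.smul_mem _ _ hv1) (Submodule.smul_mem _ _ hw1),
      Set.mem_iInter.2 fun j => ?_, ?_⟩
    · have h1 := Set.mem_iInter.1 hv2 j
      have h2 := Set.mem_iInter.1 hw2 j
      simp only [Set.mem_ofPred_eq, inner_add_right, inner_smul_right] at *
      positivity
    · simp only [Set.mem_ofPred_eq, inner_add_right, inner_smul_right] at *
      simp [hv3, hw3]
  have hNadd : ∀ v ∈ N, (2 : ℝ) • v ∈ N := by
    rintro v ⟨hv1, hv2, hv3⟩
    refine ⟨Submodule.smul_mem _ _ hv1, Set.mem_iInter.2 fun j => ?_, ?_⟩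
    · have h1 := Set.mem_iInter.1 hv2 j
      simp only [Set.mem_ofPred_eq, inner_smul_right] at *
      positivity
    · simp only [Set.mem_ofPred_eq, inner_smul_right] at *
      simp [hv3]
  obtain ⟨v, hv, hmin⟩ := exists_norm_eq_iInf_of_complete_convex ⟨0, hN0⟩ hNclosed.isComplete
    hNconv (U (Pi.single b 1))
  rw [norm_eq_iInf_iff_real_inner_le_zero hNconv hv] at hmin
  -- Since `N` is a cone, `0` and `2 • v` are both admissible test points and give opposite
  -- inequalities.
  have horth : inner ℝ (U (Pi.single b 1) - v) v = 0 := by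
    have h1 := hmin 0 hN0
    have h2 := hmin _ (hNadd v hv)
    rw [zero_sub, inner_neg_right] at h1
    rw [two_smul, add_sub_cancel_right] at h2
    linarith
  obtain ⟨⟨δ, rfl⟩, hv2, hv3⟩ := hv
  have hsingle : ∀ j (c : ι → ℝ), Pi.single j 1 ⬝ᵥ c = c j := fun j c => by simp
  refine ⟨δ, fun j => ?_, ?_, ?_, fun k hk => ?_⟩
  · have := Set.mem_iInter.1 hv2 j
    rwa [Set.mem_ofPred_eq, hU, hsingle] at this
  · rwa [Set.mem_ofPred_eq, hU, hsingle] at hv3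
  · rwa [real_inner_comm, ← map_sub, hU] at horth
  · have hkN : U (Pi.single k 1) ∈ N := by
      refine ⟨⟨_, rfl⟩, Set.mem_iInter.2 fun j => ?_, ?_⟩
      · rw [Set.mem_ofPred_eq, hU, hsingle]; simpa using hnn j k
      · rw [Set.mem_ofPred_eq, hU, hsingle]; simpa using hk
    have := hmin _ hkN
    rwa [inner_sub_right, horth, sub_zero, real_inner_comm, ← map_sub, hU, hsingle] at this

/-! ### Extreme rays of polyhedral cones, self-duality and slack matrices. -/

namespace SelfDualSlack

variable {E : Type*} [AddCommGroup E] [Module ℝ E]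

theorem mem_hull_singleton {x v : E} :
    v ∈ PointedCone.hull ℝ {x} ↔ ∃ t : ℝ, 0 ≤ t ∧ t • x = v := by
  rw [PointedCone.hull, Submodule.mem_span_singleton]
  constructor
  · rintro ⟨t, rfl⟩
    exact ⟨t, t.2, rfl⟩
  · rintro ⟨t, ht, rfl⟩
    exact ⟨⟨t, ht⟩, rfl⟩

/-- From a point `v` of a cone cut out by finitely many half-spaces, walk in the direction `-x`
until a new inequality becomes tight. -/
theorem exists_sub_smul_mem_tight {s : Finset (Module.Dual ℝ E)} {v x : E}
    (hv : ∀ f ∈ s, 0 ≤ f v) (hx : ∃ f ∈ s, 0 < f x) :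
    ∃ r : ℝ, 0 ≤ r ∧ (∀ f ∈ s, 0 ≤ f (v - r • x)) ∧ ∃ f ∈ s, 0 < f x ∧ f (v - r • x) = 0 := by
  classical
  obtain ⟨f, hf, hmin⟩ := (s.filter fun f => 0 < f x).exists_min_image (fun f => f v / f x) (by
    obtain ⟨f, hf, h⟩ := hx
    exact ⟨f, by simp [hf, h]⟩)
  rw [Finset.mem_filter] at hf
  have hr : 0 ≤ f v / f x := div_nonneg (hv f hf.1) hf.2.le
  refine ⟨f v / f x, hr, fun g hg => ?_, f, hf.1, hf.2, ?_⟩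
  · rw [map_sub, map_smul, smul_eq_mul, sub_nonneg]
    rcases lt_or_ge 0 (g x) with h | h
    · rw [← le_div_iff₀ h]
      exact hmin g (by simp [hg, h])
    · exact (mul_nonpos_of_nonneg_of_nonpos hr h).trans (hv g hg)
  · rw [map_sub, map_smul, smul_eq_mul, div_mul_cancel₀ _ hf.2.ne', sub_self]

/-- A salient cone cut out by finitely many half-spaces is generated by its extreme rays. -/
theorem mem_of_forall_isExtremeRay_le {K H : PointedCone ℝ E} (s : Finset (Module.Dual ℝ E))
    (hK : ∀ v, v ∈ K ↔ ∀ f ∈ s, 0 ≤ f v) (hsal : ∀ v ∈ K, -v ∈ K → v = 0)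
    (hH : ∀ F, IsExtremeRay K F → F ≤ H) {v : E} (hv : v ∈ K) : v ∈ H := by
  classical
  -- Induction on the number of inequalities that are strict at `v`.
  induction hn : (s.filter fun f => f v ≠ 0).card using Nat.strong_induction_on generalizing v with
  | _ n ih =>
  by_cases hv0 : v = 0
  · rw [hv0]; exact H.zero_mem
  by_cases hface : (PointedCone.hull ℝ {v}).IsFaceOf K
  · exact hH _ ⟨hface, v, hv0, rfl⟩ (mem_hull_singleton.2 ⟨1, zero_le_one, one_smul _ _⟩)
  have hpos : ∀ w ∈ K, w ≠ 0 → ∃ f ∈ s, 0 < f w := by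
    intro w hw hw0
    by_contra! h
    exact hw0 (hsal w hw ((hK _).2 fun f hf => by simpa using h f hf))
  obtain ⟨x, hxK, hxv, htight⟩ : ∃ x ∈ K, x ∉ PointedCone.hull ℝ {v} ∧
      ∀ f ∈ s, f v = 0 → f x = 0 := by
    by_contra! h
    refine hface ⟨fun w hw => ?_, fun {x y a} hx hy ha hxy => ?_⟩
    · obtain ⟨t, ht, rfl⟩ := mem_hull_singleton.1 hw
      exact K.smul_mem ht hv
    · by_contra hxv
      obtain ⟨f, hf, hfv, hfx⟩ := h x hx hxv
      obtain ⟨t, ht, htv⟩ := mem_hull_singleton.1 hxy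
      have h1 := congrArg f htv
      rw [map_add, map_smul, map_smul, hfv, smul_zero, smul_eq_mul] at h1
      have h2 := (hK x).1 hx f hf
      have h3 := (hK y).1 hy f hf
      have h4 : 0 < a * f x := mul_pos ha (lt_of_le_of_ne h2 hfx.symm)
      linarith
  have hx0 : x ≠ 0 := fun h => hxv (h ▸ Submodule.zero_mem _)
  have hless : ∀ w, (∀ f ∈ s, f v = 0 → f w = 0) → (∃ f ∈ s, f v ≠ 0 ∧ f w = 0) →
      (s.filter fun f => f w ≠ 0).card < n := by
    rintro w h1 ⟨f, hf, hfv, hfw⟩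
    rw [← hn]
    refine Finset.card_lt_card (Finset.ssubset_iff_of_subset ?_ |>.2 ⟨f, by simp [hf, hfv], ?_⟩)
    · intro g hg
      rw [Finset.mem_filter] at hg ⊢
      exact ⟨hg.1, fun h => hg.2 (h1 g hg.1 h)⟩
    · simp [hfw]
  obtain ⟨r, hr, hrK, f, hf, hfx, hfr⟩ :=
    exists_sub_smul_mem_tight ((hK v).1 hv) (hpos x hxK hx0)
  obtain ⟨q, hq, hqK, g, hg, hgv, hgq⟩ :=
    exists_sub_smul_mem_tight ((hK x).1 hxK) (hpos v hv hv0)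
  have hvH : v - r • x ∈ H := by
    refine ih _ (hless _ (fun e he hev => ?_) ⟨f, hf, ?_, hfr⟩) ((hK _).2 hrK) rfl
    · simp [hev, htight e he hev]
    · exact fun h => hfx.ne' (htight f hf h)
  have hxH : x - q • v ∈ H := by
    refine ih _ (hless _ (fun e he hev => ?_) ⟨g, hg, hgv.ne', hgq⟩) ((hK _).2 hqK) rfl
    simp [hev, htight e he hev]
  -- Both walks end in `H`. If `r * q < 1`, solve for `v`; otherwise salience gives `v = r • x`,
  -- putting `x` on the ray of `v`.
  have hsum : (1 - r * q) • v = (v - r • x) + r • (x - q • v) := by module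
  rcases lt_or_ge (r * q) 1 with h | h
  · have h' : 0 < 1 - r * q := by linarith
    have := H.smul_mem (inv_nonneg.2 h'.le) (H.add_mem hvH (H.smul_mem hr hxH))
    rwa [← hsum, inv_smul_smul₀ h'.ne'] at this
  · exfalso
    have hneg : -(v - r • x) = r • (x - q • v) + (r * q - 1) • v := by module
    have hz := hsal _ ((hK _).2 hrK) (by
      rw [hneg]
      exact K.add_mem (K.smul_mem hr ((hK _).2 hqK)) (K.smul_mem (by linarith) hv))
    have hvx := sub_eq_zero.1 hz
    have hr0 : r ≠ 0 := fun h0 => hv0 (by rw [hvx, h0, zero_smul])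
    exact hxv (mem_hull_singleton.2 ⟨r⁻¹, inv_nonneg.2 hr, by
      rw [inv_smul_eq_iff₀ hr0]; exact hvx⟩)

theorem IsInnerProduct.nondegenerate [FiniteDimensional ℝ E] {B : LinearMap.BilinForm ℝ E}
    (hB : IsInnerProduct B) : B.Nondegenerate :=
  (LinearMap.IsRefl.nondegenerate_iff_separatingLeft hB.1.isRefl).2 fun x hx => by
    by_contra h
    exact (hB.2 x h).ne' (hx x)

theorem IsInnerProduct.eq_zero_of_mem_dual {B : LinearMap.BilinForm ℝ E} (hB : IsInnerProduct B)
    {K : PointedCone ℝ E} (hK : PointedCone.dual B (K : Set E) = K) {v : E} (hv : v ∈ K)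
    (hv' : -v ∈ K) : v = 0 := by
  by_contra h
  rw [← hK, PointedCone.mem_dual] at hv'
  have := hv' hv
  rw [map_neg] at this
  linarith [hB.2 v h]

theorem mem_hull_range {ι : Type*} [Fintype ι] {x : ι → E} {v : E} :
    v ∈ PointedCone.hull ℝ (Set.range x) ↔ ∃ c : ι → ℝ, (∀ i, 0 ≤ c i) ∧ ∑ i, c i • x i = v := by
  rw [PointedCone.hull, Submodule.mem_span_range_iff_exists_fun]
  constructor
  · rintro ⟨c, rfl⟩
    exact ⟨fun i => c i, fun i => (c i).2, rfl⟩
  · rintro ⟨c, hc, rfl⟩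
    exact ⟨fun i => ⟨c i, hc i⟩, rfl⟩

theorem GeneratesExtremeRays.isExtremeRay {ι : Type*} {K : PointedCone ℝ E} {x : ι → E}
    (hx : GeneratesExtremeRays K x) (i : ι) : IsExtremeRay K (PointedCone.hull ℝ {x i}) :=
  hx.mapsTo (Set.mem_univ i)

theorem self_mem_hull_singleton (v : E) : v ∈ PointedCone.hull ℝ {v} :=
  mem_hull_singleton.2 ⟨1, zero_le_one, one_smul _ _⟩

theorem GeneratesExtremeRays.mem {ι : Type*} {K : PointedCone ℝ E} {x : ι → E}
    (hx : GeneratesExtremeRays K x) (i : ι) : x i ∈ K :=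
  (hx.isExtremeRay i).1.le (self_mem_hull_singleton _)

theorem GeneratesExtremeRays.ne_zero {ι : Type*} {K : PointedCone ℝ E} {x : ι → E}
    (hx : GeneratesExtremeRays K x) (i : ι) : x i ≠ 0 := by
  obtain ⟨-, z, hz, h⟩ := hx.isExtremeRay i
  intro h0
  have := h ▸ self_mem_hull_singleton z
  obtain ⟨t, -, ht⟩ := mem_hull_singleton.1 this
  exact hz (by rw [← ht, h0, smul_zero])

/-- A salient cone cut out by finitely many half-spaces is the hull of any family of generators of
its extreme rays. -/
theorem GeneratesExtremeRays.exists_sum_eq {ι : Type*} [Fintype ι] {K : PointedCone ℝ E}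
    {x : ι → E} (hx : GeneratesExtremeRays K x) (s : Finset (Module.Dual ℝ E))
    (hK : ∀ v, v ∈ K ↔ ∀ f ∈ s, 0 ≤ f v) (hsal : ∀ v ∈ K, -v ∈ K → v = 0) {v : E} (hv : v ∈ K) :
    ∃ c : ι → ℝ, (∀ i, 0 ≤ c i) ∧ ∑ i, c i • x i = v := by
  refine mem_hull_range.1 (mem_of_forall_isExtremeRay_le s hK hsal (fun F hF => ?_) hv)
  obtain ⟨i, -, rfl⟩ := hx.surjOn hF
  exact Submodule.span_mono (Set.singleton_subset_iff.2 ⟨i, rfl⟩)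

/-- Membership in a self-dual polyhedral cone can be tested on the generators of the extreme rays
of the dual cone with respect to any inner product. -/
theorem mem_of_forall_nonneg_extremeRays [FiniteDimensional ℝ E] {κ : Type*} [Fintype κ]
    {K : PointedCone ℝ E} (hpoly : IsPolyhedral K) (hself : IsSelfDual K)
    {β : LinearMap.BilinForm ℝ E} (hβ : IsInnerProduct β) {y : κ → E}
    (hy : GeneratesExtremeRays (PointedCone.dual β (K : Set E)) y) {v : E}
    (hv : ∀ j, 0 ≤ β v (y j)) : v ∈ K := by
  classical
  obtain ⟨B, hB, hBK⟩ := hself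
  obtain ⟨s, hs⟩ := hpoly
  have hK : ∀ v, v ∈ K ↔ ∀ f ∈ s, 0 ≤ f v := fun v => by
    rw [← hs, PointedCone.mem_dual]; rfl
  -- `M` converts `B` into `β`, so it maps `K` onto its `β`-dual and transports the extreme-ray
  -- description.
  let M : E ≃ₗ[ℝ] E := (B.toDual hB.nondegenerate).trans (β.toDual hβ.nondegenerate).symm
  have hM : ∀ v w, β v (M w) = B v w := fun v w => by
    rw [hβ.1.eq v (M w), hB.1.eq v w, LinearEquiv.trans_apply,
      LinearMap.BilinForm.apply_toDual_symm_apply, LinearMap.BilinForm.toDual_def]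
  have hdual : ∀ w, w ∈ PointedCone.dual β (K : Set E) ↔ M.symm w ∈ K := fun w => by
    rw [← hBK, PointedCone.mem_dual, PointedCone.mem_dual, hBK]
    simp only [← hM, LinearEquiv.apply_symm_apply]
  rw [← hBK, PointedCone.mem_dual]
  intro z hz
  obtain ⟨c, hc, hcz⟩ := hy.exists_sum_eq (s.image fun f => f ∘ₗ M.symm.toLinearMap)
    (fun w => by rw [hdual, hK]; simp)
    (fun w h1 h2 => by
      rw [hdual] at h1 h2
      rw [map_neg] at h2
      simpa using hB.eq_zero_of_mem_dual hBK h1 h2)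
    ((hdual (M z)).2 (by simpa using hz))
  rw [hB.1.eq, ← hM, ← hcz, map_sum]
  exact Finset.sum_nonneg fun j _ => by
    rw [map_smul, smul_eq_mul]
    exact mul_nonneg (hc j) (hv j)

/-- The order structure of a self-dual polyhedral cone in terms of its slack matrix: a vector of the
row space of `S` is nonnegative only if it is a nonnegative combination of rows, and the rows
are extreme and pairwise not proportional. -/
theorem IsSlackMatrix.rows_extreme {ι : Type*} [Fintype ι] [DecidableEq ι]
    [FiniteDimensional ℝ E] {K : PointedCone ℝ E} (hpoly : IsPolyhedral K) (hself : IsSelfDual K)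
    {S : Matrix ι ι ℝ} (hS : IsSlackMatrix K S) :
    (∀ i j, 0 ≤ S i j) ∧
    (∀ p : ι → ℝ, (∀ j, 0 ≤ (p ᵥ* S) j) →
      ∃ c : ι → ℝ, (∀ i, 0 ≤ c i) ∧ p ᵥ* S = c ᵥ* S) ∧
    (∀ (b : ι) (t : ℝ) (p q : ι → ℝ), 0 ≤ t → (∀ j, 0 ≤ (p ᵥ* S) j) → (∀ j, 0 ≤ (q ᵥ* S) j) →
      p + q = t • Pi.single b 1 → ∃ r : ℝ, p ᵥ* S = r • S b) ∧
    (∀ (a b : ι) (r : ℝ), S b = r • S a → a = b) := by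
  obtain ⟨β, hβ, x, y, hx, hy, hxy⟩ := hS
  have hmem : ∀ {v : E}, (∀ j, 0 ≤ β v (y j)) → v ∈ K :=
    mem_of_forall_nonneg_extremeRays hpoly hself hβ hy
  obtain ⟨B, hB, hBK⟩ := hself
  obtain ⟨s, hs⟩ := hpoly
  have hsal : ∀ v ∈ K, -v ∈ K → v = 0 := fun v => hB.eq_zero_of_mem_dual hBK
  let X : (ι → ℝ) →ₗ[ℝ] E := Fintype.linearCombination ℝ x
  have hX : ∀ (p : ι → ℝ) j, (p ᵥ* S) j = β (X p) (y j) := fun p j => by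
    simp [X, Fintype.linearCombination_apply, vecMul, dotProduct, hxy]
  have hXb : ∀ b, X (Pi.single b 1) = x b := fun b => by
    simp [X, Fintype.linearCombination_apply_single]
  refine ⟨fun i j => ?_, fun p hp => ?_, fun b t p q ht hp hq hpq => ?_, fun a b r hr => ?_⟩
  · rw [hxy]
    exact hy.mem j (hx.mem i)
  · obtain ⟨c, hc, hcp⟩ := hx.exists_sum_eq s
      (fun v => by rw [← hs, PointedCone.mem_dual]; rfl) hsal (hmem fun j => hX p j ▸ hp j)
    refine ⟨c, hc, funext fun j => ?_⟩
    rw [hX, hX, ← hcp]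
    rfl
  · have hpK : X p ∈ K := hmem fun j => hX p j ▸ hp j
    have hqK : X q ∈ K := hmem fun j => hX q j ▸ hq j
    have hface := (hx.isExtremeRay b).1.mem_of_smul_add_mem hpK hqK one_pos (by
      rw [one_smul, ← map_add, hpq, map_smul, hXb]
      exact mem_hull_singleton.2 ⟨t, ht, rfl⟩)
    obtain ⟨r, -, hr⟩ := mem_hull_singleton.1 hface
    refine ⟨r, funext fun j => ?_⟩
    rw [hX, ← hr]
    simp [hxy]
  · have hv : ∀ j, β (x b - r • x a) (y j) = 0 := fun j => by
      have := congrFun hr j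
      simp only [Pi.smul_apply, hxy, smul_eq_mul] at this
      simp [this]
    have hz := sub_eq_zero.1 (hsal _ (hmem fun j => (hv j).ge)
      (hmem fun j => by rw [map_neg, LinearMap.neg_apply, hv, neg_zero]))
    have hr0 : 0 < r := by
      by_contra! h
      refine hx.ne_zero b (hsal _ (hx.mem b) ?_)
      rw [hz, ← neg_smul]
      exact K.smul_mem (neg_nonneg.2 h) (hx.mem a)
    refine hx.injOn (Set.mem_univ a) (Set.mem_univ b) (le_antisymm ?_ ?_)
    · refine Submodule.span_le.2 (Set.singleton_subset_iff.2 (mem_hull_singleton.2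
        ⟨r⁻¹, inv_nonneg.2 hr0.le, ?_⟩))
      rw [hz, inv_smul_smul₀ hr0.ne']
    · exact Submodule.span_le.2 (Set.singleton_subset_iff.2 (mem_hull_singleton.2
        ⟨r, hr0.le, hz.symm⟩))

/-- A symmetric matrix with the order structure of the slack matrix of a self-dual polyhedral cone
is diagonal if it is completely positive semidefinite. -/
theorem IsCompletelyPosSemidef.isDiag {ι : Type*} [Fintype ι] [DecidableEq ι] {S : Matrix ι ι ℝ}
    (hcpsd : IsCompletelyPosSemidef S) (hS : S.PosSemidef) (hnn : ∀ i j, 0 ≤ S i j)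
    (hgen : ∀ p : ι → ℝ, (∀ j, 0 ≤ (p ᵥ* S) j) →
      ∃ c : ι → ℝ, (∀ i, 0 ≤ c i) ∧ p ᵥ* S = c ᵥ* S)
    (hext : ∀ (b : ι) (t : ℝ) (p q : ι → ℝ), 0 ≤ t → (∀ j, 0 ≤ (p ᵥ* S) j) →
      (∀ j, 0 ≤ (q ᵥ* S) j) → p + q = t • Pi.single b 1 → ∃ r : ℝ, p ᵥ* S = r • S b)
    (hinj : ∀ (a b : ι) (r : ℝ), S b = r • S a → a = b) : S.IsDiag := by
  intro a b hab
  by_contra hSab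
  have hSab : 0 < S a b := lt_of_le_of_ne (hnn a b) (Ne.symm hSab)
  have hsymm : ∀ p : ι → ℝ, S *ᵥ p = p ᵥ* S := fun p => by
    rw [← vecMul_transpose, ← conjTranspose_eq_transpose_of_trivial, hS.isHermitian.eq]
  obtain ⟨k, A, hA, hSA⟩ := hcpsd
  let T : (ι → ℝ) →ₗ[ℝ] Matrix (Fin k) (Fin k) ℝ := Fintype.linearCombination ℝ A
  have hT1 : ∀ b, T (Pi.single b 1) = A b := fun b => by
    simp [T, Fintype.linearCombination_apply_single]
  have hTA : ∀ (p : ι → ℝ) j, (T p * A j).trace = (p ᵥ* S) j := fun p j => by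
    simp [T, Fintype.linearCombination_apply, vecMul, dotProduct, Finset.sum_mul, trace_sum, hSA]
  have hTT : ∀ p q : ι → ℝ, (T p * T q).trace = q ⬝ᵥ (p ᵥ* S) := fun p q => by
    have : T q = ∑ j, q j • A j := Fintype.linearCombination_apply ℝ A q
    rw [this]
    simp [Finset.mul_sum, trace_sum, hTA, dotProduct]
  have hTherm : ∀ p, (T p).IsHermitian := fun p => by
    have : T p = ∑ j, p j • A j := Fintype.linearCombination_apply ℝ A p
    rw [this, IsHermitian, conjTranspose_sum]
    exact Finset.sum_congr rfl fun j _ => by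
      rw [conjTranspose_smul, (hA j).isHermitian.eq, star_trivial]
  have hTpsd : ∀ p : ι → ℝ, (∀ j, 0 ≤ (p ᵥ* S) j) → (T p).PosSemidef := by
    intro p hp
    obtain ⟨c, hc, hpc⟩ := hgen p hp
    -- `T` vanishes on the kernel of `S`: the squared Frobenius norm of `T p` is the quadratic form
    -- of `S` at `p`.
    have h0 : (p - c) ᵥ* S = 0 := by rw [sub_vecMul, hpc, sub_self]
    have hz : T (p - c) = 0 := by
      rw [← trace_conjTranspose_mul_self_eq_zero_iff, (hTherm _).eq, hTT, h0, dotProduct_zero]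
    rw [map_sub, sub_eq_zero] at hz
    rw [hz]
    exact posSemidef_sum _ fun i _ => (hA i).smul (hc i)
  obtain ⟨δ, hδ, hδa, hδo, hδk⟩ := hS.exists_projection_orthogonal_face hnn a b
  set γ : ι → ℝ := Pi.single b 1 - δ with hγ
  simp only [hsymm] at hδ hδa hδo hδk
  -- Where `S a j = 0` the bound is the projection inequality `hδk`; elsewhere a large `s` suffices.
  obtain ⟨s, hs, hsγ⟩ : ∃ s : ℝ, 0 ≤ s ∧ ∀ j, (γ ᵥ* S) j ≤ s * S a j := by
    refine ⟨∑ j, |(γ ᵥ* S) j| / S a j,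
      Finset.sum_nonneg fun j _ => div_nonneg (abs_nonneg _) (hnn a j), fun j => ?_⟩
    rcases (hnn a j).eq_or_lt with h | h
    · rw [← h, mul_zero]
      exact hδk j h.symm
    · rw [← div_le_iff₀ h]
      exact (div_le_div_of_nonneg_right (le_abs_self _) h.le).trans
        (Finset.single_le_sum (f := fun j => |(γ ᵥ* S) j| / S a j)
          (fun j _ => div_nonneg (abs_nonneg _) (hnn a j)) (Finset.mem_univ j))
  have hsub : ∀ (q : ι → ℝ) j,
      ((s • Pi.single a 1 - q) ᵥ* S) j = s * S a j - (q ᵥ* S) j := fun q j => by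
    simp [sub_vecMul, smul_vecMul]
  have hD := hTpsd δ hδ
  have hAD : A a * T δ = 0 := (hA a).mul_eq_zero_of_trace_mul_eq_zero hD (by
    rw [trace_mul_comm, hTA, hδa])
  have hsAD : T (s • Pi.single a 1 - γ) * T δ = 0 := by
    refine (hTpsd _ fun j => ?_).mul_eq_zero_of_trace_mul_eq_zero hD ?_
    · rw [hsub, sub_nonneg]
      exact hsγ j
    · rw [map_sub, map_smul, hT1, Matrix.sub_mul, Matrix.smul_mul, hAD, smul_zero, zero_sub,
        trace_neg, hTT, hδo, neg_zero]
  have hCD : T γ * T δ = 0 := by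
    rw [map_sub, map_smul, hT1, Matrix.sub_mul, Matrix.smul_mul, hAD, smul_zero, zero_sub,
      neg_eq_zero] at hsAD
    exact hsAD
  have hC : (T γ).PosSemidef := PosSemidef.of_add_of_mul_eq_zero (hTherm γ) hCD (by
    rw [← map_add, hγ, sub_add_cancel, hT1]
    exact hA b)
  have hγS : ∀ j, 0 ≤ (γ ᵥ* S) j := fun j => by
    rw [← hTA]
    exact hC.trace_mul_nonneg (hA j)
  obtain ⟨t, ht⟩ := hext b 1 δ γ zero_le_one hδ hγS (by rw [hγ]; simp)
  have hδ0 : δ ᵥ* S = 0 := by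
    have h := congrFun ht a
    have hba : S b a = S a b := by simpa using hS.isHermitian.apply a b
    rw [hδa, Pi.smul_apply, smul_eq_mul, hba, eq_comm, mul_eq_zero] at h
    rw [ht, h.resolve_right hSab.ne', zero_smul]
  have hγb : γ ᵥ* S = S b := by
    rw [hγ, sub_vecMul, hδ0, sub_zero, single_one_vecMul]
    rfl
  have hb : (Pi.single b 1 : ι → ℝ) ᵥ* S = S b := by
    rw [single_one_vecMul]
    rfl
  -- Row `b` is now dominated by `s` times row `a`, so extremality of `a` makes them proportional.
  obtain ⟨r, hr⟩ := hext a s (Pi.single b 1) (s • Pi.single a 1 - Pi.single b 1) hs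
    (fun j => by rw [hb]; exact hnn b j)
    (fun j => by rw [hsub, hb, sub_nonneg, ← hγb]; exact hsγ j) (by abel)
  exact hab (hinj a b r (hb ▸ hr))

end SelfDualSlack

theorem mainTheorem3 (d n : ℕ) (K : PointedCone ℝ (Fin d → ℝ))
    (hpoly : SelfDualSlack.IsPolyhedral K) (hself : SelfDualSlack.IsSelfDual K)
    (S : Matrix (Fin n) (Fin n) ℝ) (hslack : SelfDualSlack.IsSlackMatrix K S)
    (hpsd : S.PosSemidef) (hnd : ¬ S.IsDiag) :
    ¬ SelfDualSlack.IsCompletelyPosSemidef S := by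
  intro hcpsd
  obtain ⟨h1, h2, h3, h4⟩ := hslack.rows_extreme hpoly hself
  exact hnd (hcpsd.isDiag hpsd h1 h2 h3 h4)
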